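/- Let $S$ be a finite-dimensional quantum system shared by finitely many parties $i\in I$, with Hilbert space $\mathcal H_S=\bigotimes_{i\in I}\mathcal H_i$. A catalyst is another finite-dimensional system $C$ shared by the same parties (each party holds its share of both $S$ and $C$), and an LOCC protocol on $SC$ is a protocol of finitely many rounds in which the parties perform quantum measurements, with finitely many outcomes, on their own shares and broadcast the outcomes, later local operations being allowed to depend on all earlier outcomes; the associated map $\Lambda$ averages over the outcomes. Write $\|M\|_1=\mathrm{Tr}\sqrt{M^\dagger M}$. For states (density matrices) $\rho,\sigma$ of $S$ say that - $\rho$ can be converted into $\sigma$ via *correlated catalysis* if for every $\varepsilon>0$ there are a catalyst $C$ in a state $\tau^C$ and an LOCC protocol $\Lambda$ on $SC$ such that $\mu^{SC}=\Lambda(\rho^S\otimes\tau^C)$ satisfies $\|\mathrm{Tr}_C\,\mu^{SC}-\sigma^S\|_1<\varepsilon$ and $\mathrm{Tr}_S\,\mu^{SC}=\tau^C$; - $\rho$ can be converted into $\sigma$ via *correlated catalysis with decoupling* if for every $\varepsilon>0$ there are a catalyst $C$ in a state $\tau^C$ and an LOCC protocol $\Lambda$ on $SC$ such that $\|\Lambda(\rho^S\otimes\tau^C)-\sigma^S\otimes\tau^C\|_1<\varepsilon$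 and $\mathrm{Tr}_S[\Lambda(\rho^S\otimes\tau^C)]=\tau^C$. Then for every state $\rho$ of $S$ and every unit vector $|\psi\rangle\in\mathcal H_S$, $\rho$ can be converted into $|\psi\rangle\langle\psi|$ via correlated catalysis if and only if $\rho$ can be converted into $|\psi\rangle\langle\psi|$ via correlated catalysis with decoupling. -/

import Mathlib

open scoped ComplexOrder MatrixOrder

namespace LOCCCatalysis

/-! ### States and the trace norm -/

/-- A quantum state (density matrix): positive semidefinite of unit trace. -/
def IsState {m : Type} [Fintype m] (ρ : Matrix m m ℂ) : Prop :=
  ρ.PosSemidef ∧ ρ.trace = 1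

/-- A unit vector `|ψ⟩`. -/
def IsUnitVector {m : Type} [Fintype m] (ψ : m → ℂ) : Prop :=
  ∑ x, ‖ψ x‖ ^ 2 = 1

/-- The operator `|ψ⟩⟨ψ|`. -/
def ketbra {m : Type} (ψ : m → ℂ) : Matrix m m ℂ :=
  Matrix.vecMulVec ψ (star ψ)

/-- The trace norm `‖M‖₁ = Tr √(M† M)`. -/
noncomputable def traceNorm {m : Type} [Fintype m] [DecidableEq m] (M : Matrix m m ℂ) : ℝ :=
  (CFC.sqrt (M.conjTranspose * M)).trace.re

/-! ### Multipartite systems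

The parties are indexed by a finite type `ι`.  A multipartite system is a family `H : ι → Type` of
finite types: party `i` holds the Hilbert space with orthonormal basis indexed by `H i`, so the
whole system is the tensor product over `i`, with product basis indexed by `∀ i, H i`.  A joint
system (system `S` together with catalyst `C`) is `fun i => S i × C i`: party `i` holds both its
share of `S` and its share of `C`. -/

/-- Operators on the multipartite system `H` (matrices in the product basis). -/
abbrev Op {ι : Type} (H : ι → Type) : Type :=
  Matrix (∀ i, H i) (∀ i, H i) ℂ

/-- The tensor product `⨂ᵢ Aᵢ` of local operators `Aᵢ : H i → K i`. -/
def localProduct {ι : Type} [Fintype ι] {H K : ι → Type} (A : ∀ i, Matrix (K i) (H i) ℂ) :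
    Matrix (∀ i, K i) (∀ i, H i) ℂ :=
  Matrix.of fun x y => ∏ i, A i (x i) (y i)

/-- `ρ ⊗ τ` as an operator on the joint system. -/
def tensor {ι : Type} {S C : ι → Type} (ρ : Op S) (τ : Op C) : Op (fun i => S i × C i) :=
  Matrix.of fun x y =>
    ρ (fun i => (x i).1) (fun i => (y i).1) * τ (fun i => (x i).2) (fun i => (y i).2)

/-- The marginal on the system: `μ^S = Tr_C μ^{SC}`. -/
def marginalS {ι : Type} {S C : ι → Type} [Fintype (∀ i, C i)]
    (μ : Op (fun i => S i × C i)) : Op S :=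
  Matrix.of fun s s' => ∑ c : ∀ i, C i, μ (fun i => (s i, c i)) (fun i => (s' i, c i))

/-- The marginal on the catalyst: `μ^C = Tr_S μ^{SC}`. -/
def marginalC {ι : Type} {S C : ι → Type} [Fintype (∀ i, S i)]
    (μ : Op (fun i => S i × C i)) : Op C :=
  Matrix.of fun c c' => ∑ s : ∀ i, S i, μ (fun i => (s i, c i)) (fun i => (s i, c' i))

/-! ### LOCC protocols -/

/-- `IsLOCC Λ`: the map `Λ` on operators is implemented by an LOCC protocol with finitely many
rounds.  Either nothing is done, or there is a first round followed, for each outcome of it, by an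
LOCC protocol that may depend on this outcome.  In a round every party `i` performs a local
measurement on its own system, with Kraus operators `A i 0, …, A i (n i - 1)` (possibly changing
its local Hilbert space), and broadcasts the outcome `k i`.  A party which does nothing in a round
has the identity as its only Kraus operator, so that protocols where the parties act in turns are
included.  The final state is averaged over all outcomes. -/
inductive IsLOCC {ι : Type} [Fintype ι] [DecidableEq ι] :
    ∀ {H K : ι → Type} [∀ i, Fintype (H i)] [∀ i, DecidableEq (H i)]
      [∀ i, Fintype (K i)] [∀ i, DecidableEq (K i)], (Op H → Op K) → Prop
  | nothing {H : ι → Type} [∀ i, Fintype (H i)] [∀ i, DecidableEq (H i)] :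
      IsLOCC (fun X : Op H => X)
  | round {H H' K : ι → Type} [∀ i, Fintype (H i)] [∀ i, DecidableEq (H i)]
      [∀ i, Fintype (H' i)] [∀ i, DecidableEq (H' i)]
      [∀ i, Fintype (K i)] [∀ i, DecidableEq (K i)]
      (n : ι → ℕ) (A : ∀ i, Fin (n i) → Matrix (H' i) (H i) ℂ)
      (hA : ∀ i, ∑ k, (A i k).conjTranspose * A i k = 1)
      (Λ : (∀ i, Fin (n i)) → Op H' → Op K) (hΛ : ∀ k, IsLOCC (Λ k)) :
      IsLOCC (fun X : Op H => ∑ k : ∀ i, Fin (n i),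
        Λ k (localProduct (fun i => A i (k i)) * X *
          (localProduct (fun i => A i (k i))).conjTranspose))

/-! ### Catalysis -/

section Catalysis

variable {ι : Type} [Fintype ι] [DecidableEq ι] {S : ι → Type}
  [∀ i, Fintype (S i)] [∀ i, DecidableEq (S i)]

/-- `ρ` can be converted into `σ` via correlated catalysis: for every `ε > 0` there are a
(multipartite, finite-dimensional) catalyst in a state `τ` and an LOCC protocol `Λ` such that
`μ = Λ(ρ ⊗ τ)` satisfies `‖μ^S - σ‖₁ < ε` and `μ^C = τ`. -/
def CorrelatedCatalysis (ρ σ : Op S) : Prop :=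
  ∀ ε : ℝ, 0 < ε → ∃ (c : ι → ℕ) (τ : Op fun i => Fin (c i))
    (Λ : Op (fun i => S i × Fin (c i)) → Op (fun i => S i × Fin (c i))),
    IsState τ ∧ IsLOCC Λ ∧
      traceNorm (marginalS (Λ (tensor ρ τ)) - σ) < ε ∧
      marginalC (Λ (tensor ρ τ)) = τ

/-- `ρ` can be converted into `σ` via correlated catalysis with decoupling: for every `ε > 0` there
are a catalyst in a state `τ` and an LOCC protocol `Λ` such that
`‖Λ(ρ ⊗ τ) - σ ⊗ τ‖₁ < ε` and `Tr_S Λ(ρ ⊗ τ) = τ`. -/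
def CorrelatedCatalysisWithDecoupling (ρ σ : Op S) : Prop :=
  ∀ ε : ℝ, 0 < ε → ∃ (c : ι → ℕ) (τ : Op fun i => Fin (c i))
    (Λ : Op (fun i => S i × Fin (c i)) → Op (fun i => S i × Fin (c i))),
    IsState τ ∧ IsLOCC Λ ∧
      traceNorm (Λ (tensor ρ τ) - tensor σ τ) < ε ∧
      marginalC (Λ (tensor ρ τ)) = τ

end Catalysis

end LOCCCatalysis

namespace LOCCCatalysis

open Matrix

/-! ### Differences of positive semidefinite matrices and the trace norm -/

section TraceNorm

variable {m : Type} [Fintype m]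

/-! The same catalyst and protocol serve both directions; of LOCC only positivity and trace
preservation matter. A pure marginal cannot be correlated with anything: if `μ^S` is near `|ψ⟩⟨ψ|`,
the projection `|ψ⟩⟨ψ| ⊗ 1` is almost certain to accept `μ`, so by `HasTraceBound.gentle` `μ` is
near its compression, which has the form `|ψ⟩⟨ψ| ⊗ ω`. Taking catalyst marginals shows that `ω` is
near `μ^C = τ`. Conversely, partial trace does not increase the trace norm.

Estimates are made with `HasTraceBound`, which visibly adds and passes to marginals; for Hermitian
matrices the least such bound is the trace norm. -/

theorem _root_.Matrix.PosSemidef.trace_re_nonneg {A : Matrix m m ℂ} (hA : A.PosSemidef) :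
    0 ≤ A.trace.re :=
  (Complex.le_def.1 hA.trace_nonneg).1

/-- By cyclicity, `Tr (A B) = Tr (√A B √A)`. -/
theorem _root_.Matrix.PosSemidef.trace_mul_re_nonneg [DecidableEq m] {A B : Matrix m m ℂ}
    (hA : A.PosSemidef) (hB : B.PosSemidef) : 0 ≤ (A * B).trace.re := by
  have hs : (CFC.sqrt A).IsHermitian := (CFC.sqrt_nonneg A).posSemidef.isHermitian
  have h := (hB.mul_mul_conjTranspose_same (CFC.sqrt A)).trace_re_nonneg
  rwa [hs.eq, trace_mul_comm, ← mul_assoc, CFC.sqrt_mul_sqrt_self A hA.nonneg] at h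

/-- `X` is a difference of positive semidefinite matrices of total trace at most `r`. -/
def HasTraceBound (X : Matrix m m ℂ) (r : ℝ) : Prop :=
  ∃ P Q : Matrix m m ℂ, P.PosSemidef ∧ Q.PosSemidef ∧ X = P - Q ∧ P.trace.re + Q.trace.re ≤ r

theorem HasTraceBound.add {X Y : Matrix m m ℂ} {r s : ℝ} (hX : HasTraceBound X r)
    (hY : HasTraceBound Y s) : HasTraceBound (X + Y) (r + s) := by
  obtain ⟨P, Q, hP, hQ, rfl, h⟩ := hX
  obtain ⟨P', Q', hP', hQ', rfl, h'⟩ := hY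
  refine ⟨P + P', Q + Q', hP.add hP', hQ.add hQ', by abel, ?_⟩
  simp only [trace_add, Complex.add_re]
  linarith

theorem HasTraceBound.neg {X : Matrix m m ℂ} {r : ℝ} (hX : HasTraceBound X r) :
    HasTraceBound (-X) r := by
  obtain ⟨P, Q, hP, hQ, rfl, h⟩ := hX
  exact ⟨Q, P, hQ, hP, by abel, by linarith⟩

theorem HasTraceBound.mono {X : Matrix m m ℂ} {r s : ℝ} (hX : HasTraceBound X r) (h : r ≤ s) :
    HasTraceBound X s := by
  obtain ⟨P, Q, hP, hQ, rfl, h'⟩ := hX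
  exact ⟨P, Q, hP, hQ, rfl, h'.trans h⟩

theorem HasTraceBound.of_posSemidef {X : Matrix m m ℂ} (hX : X.PosSemidef) :
    HasTraceBound X X.trace.re :=
  ⟨X, 0, hX, .zero, by simp, by simp⟩

/-- With `U` the sign of `X`, `‖X‖₁ = Tr (U X) = Tr (U P) - Tr (U Q)`, and `-1 ≤ U ≤ 1` bounds the
two terms by `Tr P` and `Tr Q`. -/
theorem HasTraceBound.traceNorm_le [DecidableEq m] {X : Matrix m m ℂ} {r : ℝ}
    (hX : HasTraceBound X r) : traceNorm X ≤ r := by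
  obtain ⟨P, Q, hP, hQ, rfl, h⟩ := hX
  set X := P - Q with hXdef
  have hsa : IsSelfAdjoint X := hP.isHermitian.sub hQ.isHermitian
  -- On a finite spectrum even the discontinuous sign function is admissible in the functional
  -- calculus.
  have hfin : (spectrum ℝ X).Finite := Matrix.finite_real_spectrum
  have hcont (f : ℝ → ℝ) : ContinuousOn f (spectrum ℝ X) := hfin.continuousOn f
  let f : ℝ → ℝ := fun x => if 0 ≤ x then 1 else -1
  set U := cfc f X with hU
  have hUX : U * X = CFC.abs X := by
    rw [CFC.abs_eq_cfc_norm X hsa]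
    conv_lhs => arg 2; rw [← cfc_id' ℝ X hsa]
    rw [hU, ← cfc_mul f _ X (hcont _) (hcont _)]
    refine cfc_congr fun x _ => ?_
    by_cases hx : 0 ≤ x
    · simp [f, hx, abs_of_nonneg hx]
    · simp [f, hx, abs_of_neg (not_le.1 hx)]
  have h1 : (1 - U).PosSemidef := Matrix.le_iff.1 <| cfc_le_one f X fun x _ => by
    by_cases hx : 0 ≤ x <;> simp [f, hx]
  have h2 : (1 + U).PosSemidef := by
    have : cfc (fun x => -f x) X ≤ 1 := cfc_le_one _ X fun x _ => by
      by_cases hx : 0 ≤ x <;> simp [f, hx]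
    rw [cfc_neg] at this
    simpa using Matrix.le_iff.1 this
  have e1 := h1.trace_mul_re_nonneg hP
  have e2 := h2.trace_mul_re_nonneg hQ
  have e3 : traceNorm X = (U * X).trace.re := by rw [hUX]; rfl
  rw [e3, hXdef, mul_sub]
  simp only [sub_mul, add_mul, one_mul, trace_sub, trace_add, Complex.sub_re,
    Complex.add_re] at e1 e2 ⊢
  linarith

/-- The positive and negative parts attain the optimum, since `X⁺ + X⁻ = |X|`. -/
theorem _root_.Matrix.IsHermitian.hasTraceBound [DecidableEq m] {X : Matrix m m ℂ}
    (hX : X.IsHermitian) : HasTraceBound X (traceNorm X) := by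
  refine ⟨X⁺, X⁻, (CFC.posPart_nonneg X).posSemidef, (CFC.negPart_nonneg X).posSemidef,
    (CFC.posPart_sub_negPart X hX).symm, ?_⟩
  rw [← Complex.add_re, ← trace_add, CFC.posPart_add_negPart X hX]
  rfl

/-- Compressing a positive semidefinite matrix by a projection which is almost certain to
accept it disturbs it little. -/
theorem HasTraceBound.gentle [DecidableEq m] {μ P : Matrix m m ℂ} (hμ : μ.PosSemidef)
    (hP : P.IsHermitian) (hPP : P * P = P) {t : ℝ} (ht : 0 < t) :
    HasTraceBound (μ - P * μ * P)
      (t ^ 2 * μ.trace.re + (1 + (t ^ 2)⁻¹) * (μ.trace.re - (P * μ).trace.re)) := by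
  set Q := 1 - P with hQdef
  have hQ : Q.IsHermitian := isHermitian_one.sub hP
  have hQQ : Q * Q = Q := by simp [hQdef, mul_sub, sub_mul, hPP]
  have hPQ : P * Q = 0 := by simp [hQdef, mul_sub, hPP]
  have hQP : Q * P = 0 := by simp [hQdef, sub_mul, hPP]
  set a : ℂ := (t : ℂ) with ha
  have ha0 : a ≠ 0 := by simpa [ha] using ht.ne'
  -- Half the difference of these matrices for `c = t⁻¹` and `c = -t⁻¹` is the off-diagonal part `P
  -- μ Q + Q μ P`. The weight `t` keeps the large trace of `P μ` small, at the cost of a factor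
  -- `t⁻²` on the small trace of `Q μ`.
  have hK (c : ℝ) : (((a • P + (c : ℂ) • Q) * μ * (a • P + (c : ℂ) • Q))).PosSemidef := by
    have h := hμ.mul_mul_conjTranspose_same (a • P + (c : ℂ) • Q)
    simpa [hP.eq, hQ.eq, ha] using h
  have hplus := hK t⁻¹
  have hminus := hK (-t⁻¹)
  have hQμ : (Q * μ * Q).PosSemidef := by simpa [hQ.eq] using hμ.mul_mul_conjTranspose_same Q
  have t1 : (P * μ * P).trace = (P * μ).trace := by
    rw [trace_mul_comm, ← mul_assoc, hPP]
  have t2 : (Q * μ * Q).trace = (Q * μ).trace := by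
    rw [trace_mul_comm, ← mul_assoc, hQQ]
  have t3 : (P * μ * Q).trace = 0 := by
    rw [trace_mul_comm, ← mul_assoc, hQP]; simp
  have t4 : (Q * μ * P).trace = 0 := by
    rw [trace_mul_comm, ← mul_assoc, hPQ]; simp
  have t5 : (Q * μ).trace = μ.trace - (P * μ).trace := by simp [hQdef, sub_mul]
  have half : (0 : ℂ) ≤ 1 / 2 := by norm_num [Complex.le_def]
  have expand (c : ℂ) : (a • P + c • Q) * μ * (a • P + c • Q) =
      a ^ 2 • (P * μ * P) + (a * c) • (P * μ * Q + Q * μ * P) + c ^ 2 • (Q * μ * Q) := by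
    simp only [add_mul, mul_add, smul_mul_assoc, mul_smul_comm]
    module
  have split : μ - P * μ * P = P * μ * Q + Q * μ * P + Q * μ * Q := by
    simp only [hQdef]
    noncomm_ring
  rw [split]
  refine (HasTraceBound.add (X := P * μ * Q + Q * μ * P) (Y := Q * μ * Q)
    ⟨_, _, hplus.smul half, hminus.smul half, ?_, le_rfl⟩ (.of_posSemidef hQμ)).mono ?_
  · rw [expand, expand]
    push_cast
    have : a * (t : ℂ)⁻¹ = 1 := mul_inv_cancel₀ ha0
    rw [mul_neg, this]
    module
  · rw [expand, expand]
    have e1 : (P * μ).trace.re ≤ μ.trace.re := by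
      have := hQμ.trace_re_nonneg
      rw [t2, t5, Complex.sub_re] at this
      linarith
    have r1 : a ^ 2 = ((t ^ 2 : ℝ) : ℂ) := by simp [ha]
    have r2 : ((t⁻¹ : ℝ) : ℂ) ^ 2 = (((t ^ 2)⁻¹ : ℝ) : ℂ) := by simp
    have r3 : ((-t⁻¹ : ℝ) : ℂ) ^ 2 = (((t ^ 2)⁻¹ : ℝ) : ℂ) := by simp
    have r4 : (1 / 2 : ℂ) = ((1 / 2 : ℝ) : ℂ) := by simp
    simp only [trace_smul, trace_add, t1, t2, t3, t4, t5, r1, r2, r3, r4, smul_eq_mul,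
      Complex.add_re, Complex.re_ofReal_mul, Complex.sub_re, add_zero, mul_zero]
    nlinarith [mul_le_mul_of_nonneg_left e1 (sq_nonneg t)]

end TraceNorm

/-! ### Marginals and tensor products -/

section Bipartite

variable {ι : Type} {S C : ι → Type}

/-- A basis element of the joint system is a pair of basis elements of its parts. -/
def jointEquiv (S C : ι → Type) : (∀ i, S i × C i) ≃ (∀ i, S i) × (∀ i, C i) where
  toFun x := (fun i => (x i).1, fun i => (x i).2)
  invFun p := fun i => (p.1 i, p.2 i)
  left_inv _ := rfl
  right_inv _ := rfl

theorem sum_joint [Fintype (∀ i, S i)] [Fintype (∀ i, C i)] [Fintype (∀ i, S i × C i)]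
    (f : (∀ i, S i × C i) → ℂ) :
    ∑ x, f x = ∑ s : ∀ i, S i, ∑ c : ∀ i, C i, f fun i => (s i, c i) := by
  rw [← Fintype.sum_prod_type', ← (jointEquiv S C).symm.sum_comp]
  rfl

theorem tensor_eq_submatrix (ρ : Op S) (τ : Op C) :
    tensor ρ τ = (kroneckerMap (· * ·) ρ τ).submatrix (jointEquiv S C) (jointEquiv S C) :=
  rfl

theorem tensor_sub (ρ : Op S) (τ τ' : Op C) : tensor ρ (τ - τ') = tensor ρ τ - tensor ρ τ' := by
  ext x y
  simp [tensor, mul_sub]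

theorem marginalS_sub [Fintype (∀ i, C i)]
    (μ ν : Op fun i => S i × C i) :
    marginalS (μ - ν) = marginalS μ - marginalS ν := by
  ext x y
  simp [marginalS]

theorem marginalC_sub [Fintype (∀ i, S i)]
    (μ ν : Op fun i => S i × C i) :
    marginalC (μ - ν) = marginalC μ - marginalC ν := by
  ext x y
  simp [marginalC]

theorem isHermitian_tensor {ρ : Op S} {τ : Op C} (hρ : ρ.IsHermitian) (hτ : τ.IsHermitian) :
    (tensor ρ τ).IsHermitian := by
  ext x y
  simp only [tensor, conjTranspose_apply, of_apply, star_mul']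
  rw [hρ.apply, hτ.apply]

theorem marginalS_tensor [Fintype (∀ i, C i)] (ρ : Op S) (τ : Op C) :
    marginalS (tensor ρ τ) = τ.trace • ρ := by
  ext x y
  simp only [marginalS, tensor, of_apply, ← Finset.mul_sum, Matrix.smul_apply, smul_eq_mul, trace,
    diag_apply, mul_comm]

theorem marginalC_tensor [Fintype (∀ i, S i)] (ρ : Op S) (τ : Op C) :
    marginalC (tensor ρ τ) = ρ.trace • τ := by
  ext x y
  simp only [marginalC, tensor, of_apply, ← Finset.sum_mul, Matrix.smul_apply, smul_eq_mul, trace,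
    diag_apply]

theorem posSemidef_marginalS [Fintype (∀ i, C i)] {μ : Op fun i => S i × C i}
    (hμ : μ.PosSemidef) :
    (marginalS μ).PosSemidef := by
  have : marginalS μ =
      ∑ c : ∀ i, C i, μ.submatrix (fun s i => (s i, c i)) (fun s i => (s i, c i)) := by
    ext x y
    simp [marginalS, Matrix.sum_apply]
  rw [this]
  exact posSemidef_sum _ fun c _ => hμ.submatrix _

theorem posSemidef_marginalC [Fintype (∀ i, S i)] {μ : Op fun i => S i × C i}
    (hμ : μ.PosSemidef) :
    (marginalC μ).PosSemidef := by
  have : marginalC μ =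
      ∑ s : ∀ i, S i, μ.submatrix (fun c i => (s i, c i)) (fun c i => (s i, c i)) := by
    ext x y
    simp [marginalC, Matrix.sum_apply]
  rw [this]
  exact posSemidef_sum _ fun c _ => hμ.submatrix _

variable [Fintype ι] [∀ i, Fintype (S i)] [∀ i, Fintype (C i)]

theorem posSemidef_tensor {ρ : Op S} {τ : Op C} (hρ : ρ.PosSemidef) (hτ : τ.PosSemidef) :
    (tensor ρ τ).PosSemidef := by
  rw [tensor_eq_submatrix]
  exact (hρ.kronecker hτ).submatrix _

variable [DecidableEq ι]

theorem trace_tensor (ρ : Op S) (τ : Op C) : (tensor ρ τ).trace = ρ.trace * τ.trace := by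
  simp only [trace, diag_apply, sum_joint, Finset.sum_mul_sum]
  rfl

theorem tensor_mul_tensor (ρ ρ' : Op S) (τ τ' : Op C) :
    tensor ρ τ * tensor ρ' τ' = tensor (ρ * ρ') (τ * τ') := by
  ext x y
  simp only [mul_apply, sum_joint, tensor, of_apply, Finset.sum_mul_sum]
  exact Finset.sum_congr rfl fun _ _ => Finset.sum_congr rfl fun _ _ => by ring

theorem trace_marginalS (μ : Op fun i => S i × C i) : (marginalS μ).trace = μ.trace := by
  simp only [trace, diag_apply, sum_joint]
  rfl

theorem trace_marginalC (μ : Op fun i => S i × C i) : (marginalC μ).trace = μ.trace := by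
  simp only [trace, diag_apply, sum_joint]
  rw [Finset.sum_comm]
  rfl

theorem HasTraceBound.marginalS {X : Op fun i => S i × C i} {r : ℝ} (hX : HasTraceBound X r) :
    HasTraceBound (marginalS X) r := by
  obtain ⟨P, Q, hP, hQ, rfl, h⟩ := hX
  exact ⟨_, _, posSemidef_marginalS hP, posSemidef_marginalS hQ, marginalS_sub P Q,
    by rwa [trace_marginalS, trace_marginalS]⟩

theorem HasTraceBound.marginalC {X : Op fun i => S i × C i} {r : ℝ} (hX : HasTraceBound X r) :
    HasTraceBound (marginalC X) r := by
  obtain ⟨P, Q, hP, hQ, rfl, h⟩ := hX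
  exact ⟨_, _, posSemidef_marginalC hP, posSemidef_marginalC hQ, marginalC_sub P Q,
    by rwa [trace_marginalC, trace_marginalC]⟩

theorem HasTraceBound.tensor_left {ρ : Op S} (hρ : IsState ρ) {X : Op C} {r : ℝ}
    (hX : HasTraceBound X r) : HasTraceBound (tensor ρ X) r := by
  obtain ⟨P, Q, hP, hQ, rfl, h⟩ := hX
  exact ⟨_, _, posSemidef_tensor hρ.1 hP, posSemidef_tensor hρ.1 hQ, tensor_sub ρ P Q,
    by simpa [trace_tensor, hρ.2] using h⟩

theorem isState_tensor {ρ : Op S} {τ : Op C} (hρ : IsState ρ) (hτ : IsState τ) :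
    IsState (tensor ρ τ) :=
  ⟨posSemidef_tensor hρ.1 hτ.1, by rw [trace_tensor, hρ.2, hτ.2, one_mul]⟩

theorem trace_tensor_one_mul [∀ i, DecidableEq (C i)] (A : Op S) (μ : Op fun i => S i × C i) :
    (tensor A (1 : Op C) * μ).trace = (A * marginalS μ).trace := by
  simp only [trace, diag_apply, mul_apply, sum_joint, tensor, marginalS, of_apply,
    one_apply, mul_ite, ite_mul, mul_one, mul_zero, zero_mul, Finset.mul_sum, Finset.sum_ite_eq,
    Finset.mem_univ, if_true]
  exact Finset.sum_congr rfl fun _ _ => Finset.sum_comm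

end Bipartite

/-! ### Projecting on a pure state -/

section Pure

theorem isHermitian_ketbra {m : Type} (ψ : m → ℂ) : (ketbra ψ).IsHermitian := by
  ext x y
  simp [ketbra, vecMulVec_apply, mul_comm]

theorem IsUnitVector.star_dotProduct {m : Type} [Fintype m] {ψ : m → ℂ} (hψ : IsUnitVector ψ) :
    star ψ ⬝ᵥ ψ = 1 := by
  have h : ((∑ x, ‖ψ x‖ ^ 2 : ℝ) : ℂ) = 1 := by rw [hψ]; simp
  rw [← h]
  push_cast
  exact Finset.sum_congr rfl fun x _ => by simp [← Complex.conj_mul']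

theorem IsUnitVector.isState_ketbra {m : Type} [Fintype m] {ψ : m → ℂ} (hψ : IsUnitVector ψ) :
    IsState (ketbra ψ) :=
  ⟨posSemidef_vecMulVec_self_star ψ, by
    rw [ketbra, trace_vecMulVec, dotProduct_comm, hψ.star_dotProduct]⟩

theorem IsUnitVector.ketbra_mul_self {m : Type} [Fintype m] {ψ : m → ℂ} (hψ : IsUnitVector ψ) :
    ketbra ψ * ketbra ψ = ketbra ψ := by
  rw [ketbra, vecMulVec_mul_vecMulVec, hψ.star_dotProduct]
  simp

variable {ι : Type} {S C : ι → Type} [Fintype ι] [DecidableEq ι]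
  [∀ i, Fintype (S i)] [∀ i, Fintype (C i)] [∀ i, DecidableEq (C i)]

/-- The projection has rank one on `S`, so `ω = (⟨ψ| ⊗ 1) μ (|ψ⟩ ⊗ 1)`. -/
theorem exists_compress_eq_tensor (ψ : (∀ i, S i) → ℂ) (μ : Op fun i => S i × C i) :
    ∃ ω : Op C, tensor (ketbra ψ) 1 * μ * tensor (ketbra ψ) 1 = tensor (ketbra ψ) ω := by
  refine ⟨of fun c c' => ∑ s, (∑ t, star (ψ t) * μ (fun i => (t i, c i)) fun i => (s i, c' i)) *
    ψ s, ?_⟩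
  ext x y
  simp only [mul_apply, sum_joint, tensor, ketbra, vecMulVec_apply, of_apply, one_apply, mul_ite,
    ite_mul, mul_one, mul_zero, zero_mul, Finset.sum_ite_eq, Finset.sum_ite_eq', Finset.mem_univ,
    if_true, Pi.star_apply, Finset.mul_sum, Finset.sum_mul]
  exact Finset.sum_congr rfl fun _ _ => Finset.sum_congr rfl fun _ _ => by ring

/-- If the marginal of a state is close to a pure state, then the state is close to the product
of the pure state with the other marginal. -/
theorem hasTraceBound_sub_tensor_marginalC [∀ i, DecidableEq (S i)]
    {ψ : (∀ i, S i) → ℂ} (hψ : IsUnitVector ψ) {μ : Op fun i => S i × C i} (hμ : IsState μ)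
    {δ t : ℝ} (hδ : HasTraceBound (marginalS μ - ketbra ψ) δ) (ht : 0 < t) :
    HasTraceBound (μ - tensor (ketbra ψ) (marginalC μ))
      (2 * (t ^ 2 + (1 + (t ^ 2)⁻¹) * δ)) := by
  have hΨ := hψ.isState_ketbra
  -- Writing `μ^S = |ψ⟩⟨ψ| + P - Q`, the acceptance probability is at least `1 - ⟨ψ|Q|ψ⟩ ≥ 1 - Tr
  -- Q`.
  have hfid : 1 - (tensor (ketbra ψ) 1 * μ).trace.re ≤ δ := by
    obtain ⟨P, Q, hP, hQ, hPQ, h⟩ := hδ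
    have h1 : (1 - ketbra ψ).PosSemidef := by
      have h := posSemidef_conjTranspose_mul_self (1 - ketbra ψ)
      have hh : (1 - ketbra ψ).IsHermitian := isHermitian_one.sub (isHermitian_ketbra ψ)
      rw [hh.eq] at h
      simpa [mul_sub, sub_mul, hψ.ketbra_mul_self] using h
    have h2 := h1.trace_mul_re_nonneg hQ
    have h3 := hΨ.1.trace_mul_re_nonneg hP
    have h4 := hP.trace_re_nonneg
    rw [trace_tensor_one_mul, eq_add_of_sub_eq hPQ]
    simp only [mul_add, mul_sub, sub_mul, one_mul, hψ.ketbra_mul_self, trace_add, trace_sub,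
      Complex.add_re, Complex.sub_re, hΨ.2, Complex.one_re] at h2 ⊢
    linarith
  obtain ⟨ω, hω⟩ := exists_compress_eq_tensor ψ μ
  have hgentle := HasTraceBound.gentle (P := tensor (ketbra ψ) 1) hμ.1
    (isHermitian_tensor (isHermitian_ketbra ψ) isHermitian_one)
    (by rw [tensor_mul_tensor, hψ.ketbra_mul_self, one_mul]) ht
  rw [hω, hμ.2, Complex.one_re, mul_one] at hgentle
  replace hgentle := hgentle.mono (add_le_add_right
    (mul_le_mul_of_nonneg_left hfid (by positivity : 0 ≤ 1 + (t ^ 2)⁻¹)) (t ^ 2))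
  -- The same bound holds between `|ψ⟩⟨ψ| ⊗ μ^C` and `|ψ⟩⟨ψ| ⊗ ω`; the triangle inequality through
  -- `|ψ⟩⟨ψ| ⊗ ω` gives the factor `2`.
  have hmarg := (hgentle.marginalC.tensor_left hΨ).neg
  rw [marginalC_sub, marginalC_tensor, hΨ.2, one_smul, tensor_sub] at hmarg
  have := hgentle.add hmarg
  rw [two_mul]
  convert this using 1
  abel

end Pure

/-! ### LOCC protocols preserve states -/

section LOCC

variable {ι : Type} [Fintype ι]

theorem localProduct_conjTranspose {H K : ι → Type} (A : ∀ i, Matrix (K i) (H i) ℂ) :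
    (localProduct A)ᴴ = localProduct fun i => (A i)ᴴ := by
  ext x y
  simp [localProduct, conjTranspose_apply]

theorem localProduct_one {H : ι → Type} [∀ i, DecidableEq (H i)] :
    localProduct (fun i => (1 : Matrix (H i) (H i) ℂ)) = 1 := by
  ext x y
  simp [localProduct, one_apply, Finset.prod_ite_zero, funext_iff]

variable [DecidableEq ι]

theorem localProduct_mul {H K L : ι → Type} [∀ i, Fintype (K i)]
    (A : ∀ i, Matrix (L i) (K i) ℂ) (B : ∀ i, Matrix (K i) (H i) ℂ) :
    localProduct A * localProduct B = localProduct fun i => A i * B i := by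
  ext x y
  simp only [localProduct, mul_apply, of_apply, ← Finset.prod_mul_distrib, Finset.prod_univ_sum,
    Fintype.piFinset_univ]

theorem sum_localProduct {H K : ι → Type} {n : ι → ℕ} (A : ∀ i, Fin (n i) → Matrix (K i) (H i) ℂ) :
    ∑ k : ∀ i, Fin (n i), localProduct (fun i => A i (k i)) =
      localProduct fun i => ∑ k, A i k := by
  ext x y
  simp only [localProduct, Matrix.sum_apply, of_apply, Finset.prod_univ_sum, Fintype.piFinset_univ]

/-- The sum over joint outcomes factors into the parties' own completeness relations. -/
theorem sum_localProduct_conjTranspose_mul_self {H K : ι → Type} [∀ i, DecidableEq (H i)]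
    [∀ i, Fintype (K i)] {n : ι → ℕ} (A : ∀ i, Fin (n i) → Matrix (K i) (H i) ℂ)
    (hA : ∀ i, ∑ k, (A i k)ᴴ * A i k = 1) :
    ∑ k : ∀ i, Fin (n i), (localProduct fun i => A i (k i))ᴴ * (localProduct fun i => A i (k i)) =
      1 := by
  simp only [localProduct_conjTranspose, localProduct_mul]
  rw [sum_localProduct (fun i k => (A i k)ᴴ * A i k)]
  simp only [hA, localProduct_one]

theorem IsLOCC.posSemidef_and_trace {H K : ι → Type} [∀ i, Fintype (H i)]
    [∀ i, DecidableEq (H i)] [∀ i, Fintype (K i)] [∀ i, DecidableEq (K i)] {Λ : Op H → Op K}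
    (hΛ : IsLOCC Λ) : ∀ X : Op H, X.PosSemidef → (Λ X).PosSemidef ∧ (Λ X).trace = X.trace := by
  induction hΛ with
  | nothing => exact fun X hX => ⟨hX, rfl⟩
  | round n A hA Λ _ ih =>
    intro X hX
    have hk k := ih k _ (hX.mul_mul_conjTranspose_same (localProduct fun i => A i (k i)))
    refine ⟨posSemidef_sum _ fun k _ => (hk k).1, ?_⟩
    rw [trace_sum, Finset.sum_congr rfl fun k _ => (hk k).2,
      Finset.sum_congr rfl fun k _ => trace_mul_cycle _ X _, ← trace_sum, ← Finset.sum_mul,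
      sum_localProduct_conjTranspose_mul_self A hA, one_mul]

theorem IsLOCC.isState {H K : ι → Type} [∀ i, Fintype (H i)]
    [∀ i, DecidableEq (H i)] [∀ i, Fintype (K i)] [∀ i, DecidableEq (K i)] {Λ : Op H → Op K}
    (hΛ : IsLOCC Λ) {X : Op H} (hX : IsState X) : IsState (Λ X) :=
  ⟨(hΛ.posSemidef_and_trace X hX.1).1, (hΛ.posSemidef_and_trace X hX.1).2.trans hX.2⟩

end LOCC

end LOCCCatalysis

theorem mainTheorem7 {ι : Type} [Fintype ι] [DecidableEq ι] (S : ι → Type)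
    [∀ i, Fintype (S i)] [∀ i, DecidableEq (S i)]
    (ρ : LOCCCatalysis.Op S) (hρ : LOCCCatalysis.IsState ρ)
    (ψ : (∀ i, S i) → ℂ) (hψ : LOCCCatalysis.IsUnitVector ψ) :
    LOCCCatalysis.CorrelatedCatalysis ρ (LOCCCatalysis.ketbra ψ) ↔
      LOCCCatalysis.CorrelatedCatalysisWithDecoupling ρ (LOCCCatalysis.ketbra ψ) := by
  open LOCCCatalysis in
  constructor
  · intro h ε hε
    -- The final bound is `2 t² + 2 (1 + t⁻²) δ`. Fixing `t` first makes the first term less than `ε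
    -- / 2`; then `δ` is chosen, depending on `t`, to do the same for the second.
    obtain ⟨t, ht, htε⟩ : ∃ t : ℝ, 0 < t ∧ 2 * t ^ 2 < ε / 2 := by
      refine ⟨min 1 (ε / 8), by positivity, ?_⟩
      have h1 : min 1 (ε / 8) ≤ 1 := min_le_left _ _
      have h2 : min 1 (ε / 8) ≤ ε / 8 := min_le_right _ _
      have h3 : 0 < min 1 (ε / 8) := by positivity
      nlinarith
    have hs : 0 < 2 * (1 + (t ^ 2)⁻¹) := by positivity
    obtain ⟨c, τ, Λ, hτ, hΛ, hS, hC⟩ := h (ε / 2 / (2 * (1 + (t ^ 2)⁻¹))) (by positivity)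
    refine ⟨c, τ, Λ, hτ, hΛ, ?_, hC⟩
    have hμ := hΛ.isState (isState_tensor hρ hτ)
    have hherm : (marginalS (Λ (tensor ρ τ)) - ketbra ψ).IsHermitian :=
      (posSemidef_marginalS hμ.1).isHermitian.sub (isHermitian_ketbra ψ)
    have hbound := (hasTraceBound_sub_tensor_marginalC hψ hμ hherm.hasTraceBound ht).traceNorm_le
    rw [hC] at hbound
    have := (lt_div_iff₀ hs).1 hS
    nlinarith
  · intro h ε hε
    obtain ⟨c, τ, Λ, hτ, hΛ, hSC, hC⟩ := h ε hε
    refine ⟨c, τ, Λ, hτ, hΛ, lt_of_le_of_lt ?_ hSC, hC⟩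
    have hμ := hΛ.isState (isState_tensor hρ hτ)
    have hherm : (Λ (tensor ρ τ) - tensor (ketbra ψ) τ).IsHermitian :=
      hμ.1.isHermitian.sub (isState_tensor hψ.isState_ketbra hτ).1.isHermitian
    have hbound := hherm.hasTraceBound.marginalS.traceNorm_le
    rwa [marginalS_sub, marginalS_tensor, hτ.2, one_smul] at hbound
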